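/- Let $A$ be an arbitrary commutative ring (not necessarily Noetherian, possibly zero), and let $\mathrm{Kdim}$ denote Krull dimension, with values in $\{-\infty\}\cup\mathbb N\cup\{+\infty\}$ and $\mathrm{Kdim}\,0=-\infty$. *Depth.* For a finitely generated ideal $\mathfrak a$ of $A$ and an integer $k\ge 0$, a *Kronecker sequence of length $k$ attached to $\mathfrak a$* is a sequence $f_1,\dots,f_k$ of polynomials in some $A[X_1,\dots,X_N]$, no two of which have a variable in common, such that for each $j$ the coefficients of $f_j$ generate the ideal $\mathfrak a$. One writes $\mathrm{Gr}_A(\mathfrak a)\ge k$, and says that $\mathfrak a$ has depth $\ge k$, if such a sequence is regular, i.e. each $f_j$ is a non-zero-divisor modulo $\langle f_1,\dots,f_{j-1}\rangle$ (the last quotient is allowed to be zero, and the property does not depend on the chosen sequence). More generally, if $\mathfrak a$ has the same radical as some finitely generated ideal, $\mathrm{Gr}_A(\mathfrak a)\ge k$ means that $\mathrm{Gr}_A(\mathfrak b)\ge k$ for a finitely generated ideal $\mathfrak b$ with $\sqrt{\mathfrak b}=\sqrt{\mathfrak a}$. *Resolutions.* An $A$-module $M$ is *freely resolvable* if there is an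 exact sequence $0\to L_n\to\cdots\to L_1\to L_0\to M\to 0$ for some $n\ge 0$ with all $L_i$ free of finite rank. Then: 1. If $r\in\mathbb N$ and $\mathrm{Kdim}\,A\le r$, then every finitely generated ideal $\mathfrak a$ of $A$ of depth $>r$ (i.e. with $\mathrm{Gr}_A(\mathfrak a)\ge r+1$) contains $1$. 2. If $\mathfrak a$ is an ideal of $A$ that is finitely generated, or more generally has the same radical as a finitely generated ideal, and if $\mathrm{Gr}_A(\mathfrak a)\ge k$ with $k\in\mathbb N$, then $\mathrm{Kdim}(A/\mathfrak a)+k\le \mathrm{Kdim}\,A$ (with $-\infty+k=-\infty$). In particular, if $\mathrm{Kdim}\,A\le n$ with $n\in\mathbb N$ and $1\le k\le n+1$, then $\mathrm{Kdim}(A/\mathfrak a)\le n-k$, which for $k=n+1$ means $A/\mathfrak a=0$. 3. If $r\in\mathbb N$ and $\mathrm{Kdim}\,A\le r$, then every freely resolvable $A$-module $M$ has a resolution $0\to P_r\to\cdots\to P_0\to M\to 0$ of length $\le r$ by finitely generated projective $A$-modules. -/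

import Mathlib

universe u v

namespace KrullGrade

section Depth

variable {A : Type u} [CommRing A]

/-- The content of a multivariate polynomial: the ideal generated by its coefficients. -/
def content {σ : Type*} (p : MvPolynomial σ A) : Ideal A :=
  Ideal.span (Set.range fun m : σ →₀ ℕ => p.coeff m)

/-- `f` is a Kronecker sequence of length `k` attached to the ideal `a`: a sequence of polynomials
in `A[X_1, …, X_N]`, all of content `a`, no two of which have a variable in common. -/
structure IsKroneckerSeq (a : Ideal A) {N k : ℕ} (f : Fin k → MvPolynomial (Fin N) A) : Prop where
  content_eq : ∀ j, content (f j) = a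
  disjoint_vars : ∀ i j, i ≠ j → Disjoint (f i).vars (f j).vars

/-- `Gr_A(a) ≥ k` for a finitely generated ideal `a`: some Kronecker sequence of length `k` attached
to `a` is regular. (The choice of the sequence does not matter.) `IsWeaklyRegular` says that each
term is a non-zero-divisor modulo the preceding ones; the quotient by all of them may be zero. -/
def GradeGE (a : Ideal A) (k : ℕ) : Prop :=
  ∃ (N : ℕ) (f : Fin k → MvPolynomial (Fin N) A), IsKroneckerSeq a f ∧
    RingTheory.Sequence.IsWeaklyRegular (MvPolynomial (Fin N) A) (List.ofFn f)

/-- `Gr_A(a) ≥ k` for a radically finitely generated ideal `a`: there is a finitely generated ideal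
`b` with the same radical as `a` and `Gr_A(b) ≥ k`. Taking `b = a` covers finitely generated `a`. -/
def RadGradeGE (a : Ideal A) (k : ℕ) : Prop :=
  ∃ b : Ideal A, b.FG ∧ b.radical = a.radical ∧ GradeGE b k

end Depth

section Resolutions

/-- A resolution `0 → L n → ⋯ → L 1 → L 0 → M → 0` of the `A`-module `M`. It is
stored as an exact sequence indexed by `ℕ` with `L i = 0` for `i > n`; since `L n` may be zero as
well, this is a resolution of length at most `n`. -/
structure Resolution (A : Type u) [CommRing A] (M : Type v) [AddCommGroup M] [Module A M]
    (n : ℕ) where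
  L : ℕ → Type u
  addCommGroup : ∀ i, AddCommGroup (L i)
  module : ∀ i, Module A (L i)
  d : ∀ i, L (i + 1) →ₗ[A] L i
  augmentation : L 0 →ₗ[A] M
  augmentation_surjective : Function.Surjective augmentation
  exact_zero : Function.Exact (d 0) augmentation
  exact_succ : ∀ i, Function.Exact (d (i + 1)) (d i)
  subsingleton : ∀ i, n < i → Subsingleton (L i)

attribute [instance] Resolution.addCommGroup Resolution.module

variable (A : Type u) [CommRing A] (M : Type v) [AddCommGroup M] [Module A M]

/-- `M` is freely resolvable: it has a resolution of finite length by free modules of finite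
rank. -/
def FreelyResolvable : Prop :=
  ∃ (n : ℕ) (R : Resolution A M n), ∀ i, Module.Free A (R.L i) ∧ Module.Finite A (R.L i)

/-- `M` has a resolution of length `≤ r` by finitely generated projective modules. -/
def HasFiniteProjectiveResolution (r : ℕ) : Prop :=
  ∃ R : Resolution A M r, ∀ i, Module.Projective A (R.L i) ∧ Module.Finite A (R.L i)

end Resolutions

end KrullGrade

namespace KrullGrade

open Polynomial Matrix

/-! Noetherian arguments are replaced by two facts about the number of generators. The first is a
bound from below: an ideal generated by `r` elements whose radical contains `r + 1` terms of a
weakly regular sequence is the unit ideal (`span_eq_top_of_regular`), and an analogue holds for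
exact complexes (`span_eq_top_of_matrixExact`). Both go by induction on `r`: over `C[Y]/(∑ xᵢ Yⁱ)`
the ideal needs one generator fewer, and only one regular term, or one degree of the complex, is
lost.

The second is a bound from above, of Kronecker type: in a local ring of dimension at most `r`, every
proper finitely generated ideal is generated up to radical by `r` of its elements
(`exists_le_radical_span`). No chain condition is needed, since each step divides by a boundary
ideal, which lowers the dimension.

Together, after localization at a prime, they give that primes containing an ideal of depth at least
`k` have height at least `k` (`le_height_of_gradeGE`), whence the first two assertions. For the
third, they show that the cokernels of a finite free resolution in degrees at least `r` are locally
free (`free_cokernel_of_isLocalRing`), so the resolution can be truncated in degree `r`. -/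

/-- The generic linear combination `∑ xᵢ Yⁱ` of the entries of a tuple `x`. -/
noncomputable def genericPoly {C : Type*} [CommRing C] {r : ℕ} (x : Fin r → C) : C[X] :=
  ∑ i : Fin r, Polynomial.C (x i) * X ^ (i : ℕ)

/-! ### Removing one generator by passing to `C[Y]/(∑ xᵢ Yⁱ)`. -/

section Generic

variable {C : Type*} [CommRing C] {r : ℕ}

theorem genericPoly_coeff (x : Fin r → C) (i : Fin r) : (genericPoly x).coeff i = x i := by
  simp [genericPoly, Polynomial.coeff_X_pow, Fin.val_inj]

/-- If the entries of `x` have no common annihilator modulo `J`, their generic linear combination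
is a non-zero-divisor modulo `J`. -/
theorem mem_map_C_of_genericPoly_mul_mem (x : Fin r → C) (J : Ideal C)
    (hx : ∀ c, (∀ i, x i * c ∈ J) → c ∈ J) {h : C[X]}
    (hh : genericPoly x * h ∈ J.map (Polynomial.C : C →+* C[X])) :
    h ∈ J.map (Polynomial.C : C →+* C[X]) := by
  have key : (genericPoly x).map (Ideal.Quotient.mk J) ∈ nonZeroDivisors (C ⧸ J)[X] := by
    by_contra hn
    -- McCoy's theorem: a zero divisor in a polynomial ring is killed by a nonzero constant.
    obtain ⟨a, ha, hag⟩ := Polynomial.notMem_nonZeroDivisors_iff.1 hn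
    obtain ⟨a, rfl⟩ := Ideal.Quotient.mk_surjective a
    refine ha (Ideal.Quotient.eq_zero_iff_mem.2 (hx a fun i => ?_))
    have := congrArg (fun p => Polynomial.coeff p (i : ℕ)) hag
    simp only [Polynomial.coeff_smul, Polynomial.coeff_map, genericPoly_coeff, smul_eq_mul,
      Polynomial.coeff_zero, ← map_mul] at this
    rw [mul_comm]
    exact Ideal.Quotient.eq_zero_iff_mem.1 this
  have mem_iff : ∀ p : C[X], p ∈ J.map (Polynomial.C : C →+* C[X]) ↔
      p.map (Ideal.Quotient.mk J) = 0 := fun p => by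
    rw [Ideal.mem_map_C_iff, Polynomial.ext_iff]
    simp [Ideal.Quotient.eq_zero_iff_mem]
  rw [mem_iff, Polynomial.map_mul] at hh
  rw [mem_iff]
  exact (mul_left_mem_nonZeroDivisors_eq_zero_iff key).1 hh

theorem genericPoly_mul_eq_zero (x : Fin r → C)
    (hx : ∀ c, (∀ i, x i * c = 0) → c = 0) {h : C[X]} (hh : genericPoly x * h = 0) : h = 0 := by
  simpa using mem_map_C_of_genericPoly_mul_mem x ⊥ (by simpa using hx) (by simpa using hh)

/-- A power of an element of the radical of `I` lies in `J` if `I` annihilates it modulo `J`. -/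
theorem exists_pow_mul_mem {I J : Ideal C} {f c : C} (hf : f ∈ I.radical)
    (hc : ∀ a ∈ I, a * c ∈ J) : ∃ n : ℕ, f ^ n * c ∈ J := by
  obtain ⟨n, hn⟩ := hf
  exact ⟨n, hc _ hn⟩

theorem mul_mem_of_mem_span_range {x : Fin r → C} {J : Ideal C} {c : C} (h : ∀ i, x i * c ∈ J) :
    ∀ a ∈ Ideal.span (Set.range x), a * c ∈ J := by
  have : Ideal.span (Set.range x) ≤ Submodule.comap (LinearMap.mulRight C c) J := by
    rw [Ideal.span, Submodule.span_le]
    rintro _ ⟨i, rfl⟩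
    exact h i
  exact this

/-- The ring `C[Y]/(∑ xᵢ Yⁱ)`. -/
abbrev GenericQuot (x : Fin r → C) : Type _ := C[X] ⧸ Ideal.span {genericPoly x}

/-- The structure map of `C[Y]/(∑ xᵢ Yⁱ)`. -/
noncomputable def toGenericQuot (x : Fin r → C) : C →+* GenericQuot x :=
  (Ideal.Quotient.mk _).comp Polynomial.C

/-- The term of index `0` carries `Y⁰ = 1`, so the relation `∑ xᵢ Yⁱ = 0` expresses `x 0` through
the other entries. -/
theorem toGenericQuot_mem_span (x : Fin (r + 1) → C) (i : Fin (r + 1)) :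
    toGenericQuot x (x i) ∈ Ideal.span (Set.range fun j : Fin r => toGenericQuot x (x j.succ)) := by
  refine Fin.cases ?_ (fun j => Ideal.subset_span ⟨j, rfl⟩) i
  have h0 : Ideal.Quotient.mk (Ideal.span {genericPoly x}) (genericPoly x) = 0 :=
    Ideal.Quotient.eq_zero_iff_mem.2 (Ideal.mem_span_singleton_self _)
  have : toGenericQuot x (x 0) = - ∑ j : Fin r, toGenericQuot x (x j.succ) *
      Ideal.Quotient.mk (Ideal.span {genericPoly x}) (X ^ (j.succ : ℕ)) := by
    rw [eq_neg_iff_add_eq_zero, ← h0]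
    have hg : genericPoly x = Polynomial.C (x 0) +
        ∑ j : Fin r, Polynomial.C (x j.succ) * X ^ (j.succ : ℕ) := by
      simp [genericPoly, Fin.sum_univ_succ]
    rw [congrArg (Ideal.Quotient.mk (Ideal.span {genericPoly x})) hg]
    simp [toGenericQuot]
  rw [this]
  exact neg_mem (Ideal.sum_mem _ fun j _ => Ideal.mul_mem_right _ _ (Ideal.subset_span ⟨j, rfl⟩))

theorem toGenericQuot_mem_radical (x : Fin (r + 1) → C) {f : C}
    (hf : f ∈ (Ideal.span (Set.range x)).radical) :
    toGenericQuot x f ∈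
      (Ideal.span (Set.range fun j : Fin r => toGenericQuot x (x j.succ))).radical := by
  obtain ⟨n, hn⟩ := hf
  refine ⟨n, ?_⟩
  rw [← map_pow]
  have : Ideal.span (Set.range x) ≤ (Ideal.span (Set.range fun j : Fin r =>
      toGenericQuot x (x j.succ))).comap (toGenericQuot x) := by
    rw [Ideal.span_le]
    rintro _ ⟨i, rfl⟩
    exact toGenericQuot_mem_span x i
  exact this hn

/-- No information is lost: modulo all the `x i` the generic polynomial vanishes, so `Y ↦ 0` maps
the generic quotient to `C ⧸ (x)` and kills the remaining generators. -/
theorem span_eq_top_of_genericQuot (x : Fin (r + 1) → C)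
    (h : Ideal.span (Set.range fun j : Fin r => toGenericQuot x (x j.succ)) = ⊤) :
    Ideal.span (Set.range x) = ⊤ := by
  set I := Ideal.span (Set.range x) with hI
  have hxI : ∀ i, Ideal.Quotient.mk I (x i) = 0 := fun i =>
    Ideal.Quotient.eq_zero_iff_mem.2 (Ideal.subset_span ⟨i, rfl⟩)
  let φ : C[X] →+* C ⧸ I := Polynomial.eval₂RingHom (Ideal.Quotient.mk I) 0
  have hφ : ∀ a ∈ Ideal.span {genericPoly x}, φ a = 0 := by
    intro a ha
    obtain ⟨b, rfl⟩ := Ideal.mem_span_singleton'.1 ha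
    have : φ (genericPoly x) = 0 := by
      simp [φ, genericPoly, hxI]
    rw [map_mul, this, mul_zero]
  let ψ : GenericQuot x →+* C ⧸ I := Ideal.Quotient.lift _ φ hφ
  have hle : Ideal.span (Set.range fun j : Fin r => toGenericQuot x (x j.succ)) ≤
      RingHom.ker ψ := by
    rw [Ideal.span_le]
    rintro _ ⟨j, rfl⟩
    simp [ψ, toGenericQuot, φ, hxI, RingHom.mem_ker]
  rw [h] at hle
  have h1 : ψ 1 = 0 := hle Submodule.mem_top
  rw [map_one, ← map_one (Ideal.Quotient.mk I), Ideal.Quotient.eq_zero_iff_mem] at h1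
  exact (Ideal.eq_top_iff_one _).2 h1

end Generic

/-! ### Regular sequences in the radical of an ideal with few generators. -/

/-- If `r + 1` elements forming a weakly regular sequence lie in the radical of an ideal generated
by `r` elements, then this ideal contains `1`. -/
theorem span_eq_top_of_regular (r : ℕ) : ∀ {C : Type u} [CommRing C] (x : Fin r → C) (f : ℕ → C),
    (∀ i ≤ r, ∀ c, f i * c ∈ Ideal.span (f '' Set.Iio i) → c ∈ Ideal.span (f '' Set.Iio i)) →
    (∀ i ≤ r, f i ∈ (Ideal.span (Set.range x)).radical) → Ideal.span (Set.range x) = ⊤ := by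
  induction r with
  | zero =>
    intro C _ x f hreg hf
    have h0 : ∀ c, f 0 * c = 0 → c = 0 := by simpa using hreg 0 le_rfl
    obtain ⟨n, hn⟩ := hf 0 le_rfl
    have hn' : f 0 ^ n = 0 := by simpa using hn
    have h1 : ∀ n : ℕ, f 0 ^ n = 0 → (1 : C) = 0 := by
      intro n
      induction n with
      | zero => simp
      | succ n ih => intro h; exact ih (h0 _ (by rwa [← pow_succ']))
    rw [Ideal.eq_top_iff_one, h1 n hn']
    exact zero_mem _
  | succ r ih =>
    intro C _ x f hreg hf
    refine span_eq_top_of_genericQuot x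
      (ih _ (fun i => toGenericQuot x (f i)) ?_ fun i hi =>
        toGenericQuot_mem_radical x (hf i (by omega)))
    -- A common annihilator of the `x l` modulo the first `i` terms is killed by a power of `f i`,
    -- which is regular there. The case `i = r + 1` uses the last term, which is then given up.
    have hann : ∀ i ≤ r + 1, ∀ c, (∀ l, x l * c ∈ Ideal.span (f '' Set.Iio i)) →
        c ∈ Ideal.span (f '' Set.Iio i) := by
      intro i hi c hc
      obtain ⟨n, hn⟩ := exists_pow_mul_mem (hf i hi) (mul_mem_of_mem_span_range hc)
      induction n with
      | zero => simpa using hn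
      | succ n ihn => exact ihn (hreg i hi _ (by rwa [← mul_assoc, ← pow_succ']))
    intro i hi c hc
    have himg : Ideal.span ((fun i => toGenericQuot x (f i)) '' Set.Iio i) =
        ((Ideal.span (f '' Set.Iio i)).map (Polynomial.C : C →+* C[X])).map
          (Ideal.Quotient.mk (Ideal.span {genericPoly x})) := by
      rw [Ideal.map_map, Ideal.map_span, Set.image_image]
      rfl
    have hmem : ∀ p : C[X], Ideal.Quotient.mk (Ideal.span {genericPoly x}) p ∈
        ((Ideal.span (f '' Set.Iio i)).map (Polynomial.C : C →+* C[X])).map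
          (Ideal.Quotient.mk (Ideal.span {genericPoly x})) ↔
        ∃ h, p - genericPoly x * h ∈ (Ideal.span (f '' Set.Iio i)).map
          (Polynomial.C : C →+* C[X]) := by
      intro p
      rw [← Ideal.mem_comap, Ideal.comap_map_of_surjective _ Ideal.Quotient.mk_surjective,
        ← RingHom.ker_eq_comap_bot, Ideal.mk_ker, Submodule.mem_sup]
      constructor
      · rintro ⟨y, hy, z, hz, rfl⟩
        obtain ⟨h, rfl⟩ := Ideal.mem_span_singleton.1 hz
        exact ⟨h, by simpa using hy⟩
      · rintro ⟨h, hh⟩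
        exact ⟨_, hh, genericPoly x * h, Ideal.mem_span_singleton.2 ⟨h, rfl⟩, by ring⟩
    obtain ⟨c, rfl⟩ := Ideal.Quotient.mk_surjective c
    rw [himg] at hc ⊢
    rw [toGenericQuot, RingHom.comp_apply, ← map_mul, hmem] at hc
    obtain ⟨h, hh⟩ := hc
    set J := Ideal.span (f '' Set.Iio i) with hJ
    have hsucc : Ideal.span (f '' Set.Iio (i + 1)) = J ⊔ Ideal.span {f i} := by
      rw [hJ, ← Ideal.span_union, ← Set.image_singleton, ← Set.image_union]
      congr 2
      ext l
      simp [le_iff_lt_or_eq, or_comm]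
    have hsuccC : (Ideal.span (f '' Set.Iio (i + 1))).map (Polynomial.C : C →+* C[X]) =
        J.map Polynomial.C ⊔ Ideal.span {Polynomial.C (f i)} := by
      rw [hsucc, Ideal.map_sup, Ideal.map_span Polynomial.C {f i}, Set.image_singleton]
    -- Exchange argument: from `f i * c ≡ g h` modulo `J`, with `g` the generic polynomial,
    -- regularity of `g` modulo `J + (f i)` gives `h ≡ f i * h'` modulo `J`. Then `f i` can be
    -- cancelled from `f i * (c - g h')`.
    have hh1 : h ∈ (Ideal.span (f '' Set.Iio (i + 1))).map (Polynomial.C : C →+* C[X]) := by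
      refine mem_map_C_of_genericPoly_mul_mem x _ (hann (i + 1) (by omega)) ?_
      rw [hsuccC]
      rw [show genericPoly x * h = -(Polynomial.C (f i) * c - genericPoly x * h) +
        Polynomial.C (f i) * c by ring]
      exact add_mem (neg_mem (Ideal.mem_sup_left hh)) (Ideal.mem_sup_right
        (Ideal.mem_span_singleton.2 ⟨c, rfl⟩))
    rw [hsuccC, Submodule.mem_sup] at hh1
    obtain ⟨y, hy, z, hz, rfl⟩ := hh1
    obtain ⟨h', rfl⟩ := Ideal.mem_span_singleton.1 hz
    refine (hmem c).2 ⟨h', ?_⟩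
    have h2 : Polynomial.C (f i) * (c - genericPoly x * h') ∈
        J.map (Polynomial.C : C →+* C[X]) := by
      rw [show Polynomial.C (f i) * (c - genericPoly x * h') = (Polynomial.C (f i) * c -
        genericPoly x * (y + Polynomial.C (f i) * h')) + genericPoly x * y by ring]
      exact add_mem hh (Ideal.mul_mem_left _ _ hy)
    rw [Ideal.mem_map_C_iff] at h2 ⊢
    intro n
    exact hreg i (by omega) _ (by simpa using h2 n)

/-! ### Exact complexes of finite free modules. -/

/-- A sequence of matrices, viewed as a complex of finite free modules whose term in degree `i` is
`ι i → C`, that is exact except in degree `0`. -/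
structure MatrixExact {C : Type*} [CommRing C] {ι : ℕ → Type*} [∀ i, Fintype (ι i)]
    (D : ∀ i, Matrix (ι i) (ι (i + 1)) C) : Prop where
  mul_eq_zero : ∀ i, D i * D (i + 1) = 0
  exact : ∀ i w, D i *ᵥ w = 0 → ∃ u, w = D (i + 1) *ᵥ u

/-- The finitely generated ideal `(v)` lies in the radical of the annihilator of `c`, so some power
of it kills `c`; the factors are removed one at a time. -/
theorem eq_zero_of_pow_mul_eq_zero {C : Type*} [CommRing C] {κ : Type*} [Finite κ] {v : κ → C}
    (hv : ∀ c, (∀ i, v i * c = 0) → c = 0) {c : C} (hc : ∀ i, ∃ n : ℕ, v i ^ n * c = 0) :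
    c = 0 := by
  let Z : C → Ideal C := fun c => LinearMap.ker (LinearMap.mulRight C c)
  have hZ : ∀ a c, a ∈ Z c ↔ a * c = 0 := fun a c => by simp [Z]
  have hle : Ideal.span (Set.range v) ≤ (Z c).radical := by
    rw [Ideal.span_le]
    rintro _ ⟨i, rfl⟩
    obtain ⟨n, hn⟩ := hc i
    exact ⟨n, (hZ _ _).2 hn⟩
  obtain ⟨N, hN⟩ := Ideal.exists_pow_le_of_le_radical_of_fg hle
    ⟨(Set.finite_range v).toFinset, by simp⟩
  clear hc hle
  induction N generalizing c with
  | zero =>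
    have : (1 : C) ∈ Z c := hN (by simp)
    simpa [hZ] using this
  | succ N ih =>
    refine hv c fun i => ih fun a ha => ?_
    rw [hZ, ← mul_assoc, ← hZ]
    refine hN ?_
    rw [pow_succ]
    exact Ideal.mul_mem_mul ha (Ideal.subset_span ⟨i, rfl⟩)

namespace MatrixExact

variable {C : Type*} [CommRing C] {ι : ℕ → Type*} [∀ i, Fintype (ι i)]
  {D : ∀ i, Matrix (ι i) (ι (i + 1)) C}

theorem mulVec_mulVec (hD : MatrixExact D) (i : ℕ) (u) : D i *ᵥ (D (i + 1) *ᵥ u) = 0 := by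
  rw [Matrix.mulVec_mulVec, hD.mul_eq_zero, Matrix.zero_mulVec]

theorem map_C_mulVec_coeff {m n : Type*} [Fintype n] (M : Matrix m n C) (w : n → C[X]) (i : m)
    (k : ℕ) : ((M.map Polynomial.C *ᵥ w) i).coeff k = (M *ᵥ fun a => (w a).coeff k) i := by
  simp [Matrix.mulVec, dotProduct, Polynomial.finsetSum_coeff]

theorem polynomial (hD : MatrixExact D) :
    MatrixExact fun i => (D i).map (Polynomial.C : C →+* C[X]) where
  mul_eq_zero i := by
    rw [← Matrix.map_mul, hD.mul_eq_zero, Matrix.map_zero _ (map_zero _)]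
  exact i w hw := by
    have h : ∀ k, ∃ u, (fun a => (w a).coeff k) = D (i + 1) *ᵥ u := fun k => by
      refine hD.exact i _ (funext fun a => ?_)
      have := congrArg (fun p => Polynomial.coeff p k) (congrFun hw a)
      simpa [map_C_mulVec_coeff] using this
    choose u hu using h
    let N := (Finset.univ.sup fun a => (w a).natDegree) + 1
    have hN : ∀ a k, N ≤ k → (w a).coeff k = 0 := fun a k hk =>
      Polynomial.coeff_eq_zero_of_natDegree_lt (lt_of_lt_of_le
        (Nat.lt_succ_of_le (Finset.le_sup (f := fun a => (w a).natDegree) (Finset.mem_univ a))) hk)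
    refine ⟨fun b => ∑ k ∈ Finset.range N, Polynomial.monomial k (u k b), funext fun a => ?_⟩
    ext k
    rw [map_C_mulVec_coeff]
    by_cases hk : k < N
    · simpa [Polynomial.finsetSum_coeff, Polynomial.coeff_monomial, hk] using congrFun (hu k) a
    · have h0 : (fun b => (∑ k ∈ Finset.range N, Polynomial.monomial k (u k b)).coeff k) = 0 := by
        funext b
        simp [Polynomial.finsetSum_coeff, Polynomial.coeff_monomial, hk]
      rw [h0, Matrix.mulVec_zero, hN a k (not_lt.1 hk), Pi.zero_apply]

/-- If `c` kills the image of `e`, then `c • e` is a cycle, hence a boundary, and `l` takes on it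
both the value `c` and the value `0`. -/
theorem annihilator_eq_zero (hD : MatrixExact D) (j : ℕ) (e l : ι (j + 1) → C)
    (hl : l ᵥ* D (j + 1) = 0) (he : l ⬝ᵥ e = 1) (c : C) (hc : ∀ i, (D j *ᵥ e) i * c = 0) :
    c = 0 := by
  obtain ⟨u, hu⟩ := hD.exact j (c • e) (by
    rw [Matrix.mulVec_smul]
    exact funext fun i => (mul_comm _ _).trans (hc i))
  calc c = l ⬝ᵥ (c • e) := by rw [dotProduct_smul, he, smul_eq_mul, mul_one]
    _ = 0 := by rw [hu, Matrix.dotProduct_mulVec, hl, zero_dotProduct]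

/-- Modulo a non-zero-divisor, an exact complex stays exact after dropping its last term. -/
theorem quotient (hD : MatrixExact D) (g : C) (hg : ∀ c, g * c = 0 → c = 0) :
    MatrixExact fun i => (D (i + 1)).map (Ideal.Quotient.mk (Ideal.span {g})) where
  mul_eq_zero i := by
    rw [← Matrix.map_mul, hD.mul_eq_zero, Matrix.map_zero _ (map_zero _)]
  exact i w hw := by
    choose v hv using fun a => Ideal.Quotient.mk_surjective (I := Ideal.span {g}) (w a)
    have hmap : ∀ {m n : Type _} [Fintype n] (M : Matrix m n C) (y : n → C),
        (M.map (Ideal.Quotient.mk (Ideal.span {g})) *ᵥ fun a => Ideal.Quotient.mk _ (y a)) =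
          fun a => Ideal.Quotient.mk _ ((M *ᵥ y) a) := fun M y => by
      funext a
      simp [Matrix.mulVec, dotProduct]
    obtain rfl : w = fun a => Ideal.Quotient.mk _ (v a) := funext fun a => (hv a).symm
    rw [hmap] at hw
    have h1 : ∀ a, ∃ z, (D (i + 1) *ᵥ v) a = g * z := fun a =>
      Ideal.mem_span_singleton.1 (Ideal.Quotient.eq_zero_iff_mem.1 (congrFun hw a))
    choose z hz using h1
    have hz' : D (i + 1) *ᵥ v = g • z := funext hz
    -- Correcting the lift `v` by a multiple of `g` needs exactness one degree lower; this is why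
    -- the degree `0` term is lost.
    have h2 : D i *ᵥ z = 0 := by
      have h3 : g • (D i *ᵥ z) = 0 := by
        rw [← Matrix.mulVec_smul, ← hz', hD.mulVec_mulVec]
      exact funext fun a => hg _ (congrFun h3 a)
    obtain ⟨t, rfl⟩ := hD.exact i z h2
    obtain ⟨u, hu⟩ := hD.exact (i + 1) (v - g • t) (by
      rw [Matrix.mulVec_sub, Matrix.mulVec_smul, hz', sub_self])
    refine ⟨fun b => Ideal.Quotient.mk _ (u b), ?_⟩
    rw [hmap, ← hu]
    funext a
    refine Ideal.Quotient.eq.2 ?_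
    simpa using Ideal.mul_mem_right (t a) _ (Ideal.mem_span_singleton_self g)

end MatrixExact

/-- If `e` is a vector in degree `j + 1` of an exact complex on which a functional killing
boundaries takes the value `1`, then the image of `e` in degree `j` cannot have its coordinates in
the radical of a proper ideal generated by `r ≤ j` elements. -/
theorem span_eq_top_of_matrixExact (r : ℕ) : ∀ {C : Type u} [CommRing C] (x : Fin r → C)
    {ι : ℕ → Type v} [∀ i, Fintype (ι i)] (D : ∀ i, Matrix (ι i) (ι (i + 1)) C) (j : ℕ)
    (e l : ι (j + 1) → C), MatrixExact D → r ≤ j → l ᵥ* D (j + 1) = 0 → l ⬝ᵥ e = 1 →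
    (∀ i, (D j *ᵥ e) i ∈ (Ideal.span (Set.range x)).radical) →
    Ideal.span (Set.range x) = ⊤ := by
  induction r with
  | zero =>
    intro C _ x ι _ D j e l hD _ hl he hv
    have h1 := MatrixExact.annihilator_eq_zero hD j e l hl he
    refine (Ideal.eq_top_iff_one _).2 ?_
    rw [eq_zero_of_pow_mul_eq_zero (c := 1) h1 fun i => ?_]
    · exact zero_mem _
    · obtain ⟨n, hn⟩ := hv i
      exact ⟨n, by simpa using hn⟩
  | succ r ih =>
    intro C _ x ι _ D j e l hD hj hl he hv
    obtain ⟨j, rfl⟩ := Nat.exists_eq_succ_of_ne_zero (show j ≠ 0 by omega)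
    have hann : ∀ c, (∀ i, x i * c = 0) → c = 0 := fun c hc =>
      eq_zero_of_pow_mul_eq_zero (MatrixExact.annihilator_eq_zero hD _ e l hl he) fun i => by
        obtain ⟨n, hn⟩ := exists_pow_mul_mem (J := ⊥) (c := c) (hv i)
          (mul_mem_of_mem_span_range (by simpa using hc))
        exact ⟨n, by simpa using hn⟩
    -- The quotient complex is shifted by one, so `j` and the number of generators drop together and
    -- `r ≤ j` persists.
    have hD' := hD.polynomial.quotient (genericPoly x) fun h hh =>
      genericPoly_mul_eq_zero x hann hh
    refine span_eq_top_of_genericQuot x (ih _ _ j (fun a => toGenericQuot x (e a))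
      (fun a => toGenericQuot x (l a)) hD' (by omega) ?_ ?_ fun i => ?_)
    · funext a
      have := congrArg (toGenericQuot x) (congrFun hl a)
      simpa [Matrix.vecMul, dotProduct, toGenericQuot] using this
    · simpa [dotProduct] using congrArg (toGenericQuot x) he
    · have := toGenericQuot_mem_radical x (hv i)
      simpa [Matrix.mulVec, dotProduct, toGenericQuot] using this

/-! ### Boundary ideals and generation up to radical. -/

theorem comap_quotient_mk_strictMono {A : Type*} [CommRing A] (I : Ideal A) :
    StrictMono (PrimeSpectrum.comap (Ideal.Quotient.mk I)) :=
  Monotone.strictMono_of_injective (fun _ _ h => Ideal.comap_mono h)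
    (PrimeSpectrum.comap_injective_of_surjective _ Ideal.Quotient.mk_surjective)

/-- A prime containing `x` and every `z` such that `x z` is nilpotent is not minimal. -/
theorem exists_lt_of_boundary_le {A : Type*} [CommRing A] {x : A} (p : PrimeSpectrum A)
    (hx : x ∈ p.asIdeal) (hp : ∀ z, IsNilpotent (x * z) → z ∈ p.asIdeal) : ∃ q, q < p := by
  -- A prime avoiding all `x ^ n * s` with `s ∉ p` lies in `p` and omits `x`. If such a product were
  -- `0`, then `x * s` would be nilpotent, forcing `s ∈ p`.
  obtain ⟨q, hq, -, hdis⟩ := Ideal.exists_le_prime_disjoint (⊥ : Ideal A)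
    (Submonoid.powers x ⊔ p.asIdeal.primeCompl) (by
      rw [Set.disjoint_left]
      rintro _ h0 hS
      obtain rfl := (Submodule.mem_bot A).1 h0
      obtain ⟨_, ⟨n, rfl⟩, s, hs, h⟩ := Submonoid.mem_sup.1 hS
      refine hs (hp s ⟨n + 1, ?_⟩)
      rw [mul_pow, pow_succ, pow_succ' s, show x ^ n * x * (s * s ^ n) =
        (x ^ n * s) * (x * s ^ n) by ring]
      simp only at h
      rw [h, zero_mul])
  rw [Set.disjoint_left] at hdis
  refine ⟨⟨q, hq⟩, lt_of_le_of_ne (fun z hz => ?_) ?_⟩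
  · by_contra hzp
    exact hdis hz (Submonoid.mem_sup_right hzp)
  · rintro rfl
    exact hdis hx (Submonoid.mem_sup_left (Submonoid.mem_powers x))

/-- If the primes avoiding `a` have height less than `r`, then `r` elements can be modified by
multiples of `a` so that `a` is in the radical of the ideal that they generate. -/
theorem exists_mem_radical_of_height_lt (r : ℕ) : ∀ {A : Type u} [CommRing A] (a : A)
    (x : Fin r → A), (∀ p : PrimeSpectrum A, a ∉ p.asIdeal → Order.height p < r) →
    ∃ y : Fin r → A, a ∈ (Ideal.span (Set.range fun i => x i + a * y i)).radical := by
  induction r with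
  | zero =>
    intro A _ a x h
    refine ⟨x, ?_⟩
    have : IsNilpotent a := by
      rw [nilpotent_iff_mem_prime]
      intro p hp
      by_contra hap
      exact not_lt_zero (h ⟨p, hp⟩ hap)
    obtain ⟨n, hn⟩ := this
    exact ⟨n, by simp [hn]⟩
  | succ r ih =>
    intro A _ a x h
    -- After inverting `a`, the ideal `(x 0) + N` becomes the boundary ideal of `x 0`. A chain of
    -- primes above it that avoid `a` can be extended downwards, so the height bound drops by one in
    -- the quotient.
    let N : Ideal A := Submodule.comap (LinearMap.mulLeft A (x 0 * a)) (nilradical A)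
    let I : Ideal A := Ideal.span {x 0} ⊔ N
    have hht : ∀ q : PrimeSpectrum (A ⧸ I), Ideal.Quotient.mk I a ∉ q.asIdeal →
        Order.height q < r := by
      intro q hq
      by_contra hr
      obtain ⟨l, rfl, hl⟩ := Order.exists_series_of_le_height q (not_lt.1 hr)
      let l' := l.map _ (comap_quotient_mk_strictMono I)
      have hle : l'.head ≤ l'.last := LTSeries.head_le_last l'
      have hI : I ≤ l'.head.asIdeal := fun z hz => by
        change Ideal.Quotient.mk I z ∈ l.head.asIdeal
        rw [Ideal.Quotient.eq_zero_iff_mem.2 hz]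
        exact zero_mem _
      have ha : a ∉ l'.head.asIdeal := fun ha => hq (hle ha)
      obtain ⟨p, hp⟩ := exists_lt_of_boundary_le (x := x 0) l'.head
        (hI (Ideal.mem_sup_left (Ideal.mem_span_singleton_self _))) fun z hz =>
          hI (Ideal.mem_sup_right (by
            rw [Submodule.mem_comap, LinearMap.mulLeft_apply, mul_right_comm, mul_comm]
            exact Ideal.mul_mem_left _ _ (mem_nilradical.2 hz)))
      have hlast : ((l'.cons p hp).last) = l'.last := RelSeries.last_cons _ _ _
      have := h l'.last (fun ha => hq ha)
      rw [← hlast] at this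
      refine absurd (lt_of_le_of_lt Order.length_le_height_last this) ?_
      have hlen : (l'.cons p hp).length = r + 1 := by
        rw [RelSeries.cons_length, ← hl]
        rfl
      rw [hlen]
      exact lt_irrefl _
    obtain ⟨y, n, hn⟩ := ih (Ideal.Quotient.mk I a) (fun i => Ideal.Quotient.mk I (x i.succ)) hht
    choose y' hy' using fun i => Ideal.Quotient.mk_surjective (I := I) (y i)
    have hmem : a ^ n ∈ Ideal.span (Set.range fun i => x i.succ + a * y' i) ⊔ I := by
      rw [← Ideal.mk_ker (I := I), RingHom.ker_eq_comap_bot,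
        ← Ideal.comap_map_of_surjective _ Ideal.Quotient.mk_surjective, Ideal.mem_comap,
        Ideal.map_span, ← Set.range_comp, map_pow]
      have heq : (Ideal.Quotient.mk I ∘ fun i => x i.succ + a * y' i) = fun i =>
          Ideal.Quotient.mk I (x i.succ) + Ideal.Quotient.mk I a * y i := by
        funext i
        simp [hy']
      rw [heq]
      exact hn
    obtain ⟨b, hb, c, hc, hbc⟩ := Submodule.mem_sup.1 hmem
    obtain ⟨d, hd, z, hz, rfl⟩ := Submodule.mem_sup.1 hc
    obtain ⟨d, rfl⟩ := Ideal.mem_span_singleton.1 hd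
    -- The component `z ∈ N` of `a ^ n` serves as the first coefficient: `x 0 + a * z` lies in `J`
    -- and `x 0 * (a * z)` is nilpotent, so both summands lie in the radical of `J`.
    refine ⟨Fin.cons z y', ?_⟩
    set J := Ideal.span (Set.range fun i : Fin (r + 1) => x i + a * (Fin.cons z y' : Fin (r + 1) → A) i)
      with hJ
    have h0 : x 0 + a * z ∈ J := Ideal.subset_span ⟨0, by simp⟩
    have hnil : x 0 * (a * z) ∈ J.radical :=
      Ideal.radical_mono bot_le (by
        have : x 0 * a * z ∈ nilradical A := hz
        rwa [← mul_assoc])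
    have hx0 : x 0 ∈ J.radical := by
      rw [← Ideal.radical_idem]
      refine ⟨2, ?_⟩
      rw [show x 0 ^ 2 = x 0 * (x 0 + a * z) - x 0 * (a * z) by ring]
      exact sub_mem (Ideal.mul_mem_left _ _ (Ideal.le_radical h0)) hnil
    have haz : a * z ∈ J.radical := by
      have := sub_mem (Ideal.le_radical h0) hx0
      rwa [add_sub_cancel_left] at this
    have hbJ : b ∈ J := by
      refine Ideal.span_mono ?_ hb
      rintro _ ⟨i, rfl⟩
      exact ⟨i.succ, by simp⟩
    rw [← Ideal.radical_idem]
    refine ⟨n + 1, ?_⟩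
    rw [pow_succ, ← hbc, show (b + (x 0 * d + z)) * a = b * a + x 0 * (d * a) + a * z by ring]
    exact add_mem (add_mem (Ideal.le_radical (Ideal.mul_mem_right _ _ hbJ))
      (Ideal.mul_mem_right _ _ hx0)) haz

/-- In a local ring of dimension at most `r`, a proper finitely generated ideal is generated by
`r` elements up to radical. -/
theorem exists_le_radical_span {A : Type u} [CommRing A] [IsLocalRing A] {r : ℕ}
    (hr : ringKrullDim A ≤ r) {b : Ideal A} (hb : b.FG) (hbm : b ≤ IsLocalRing.maximalIdeal A) :
    ∃ x : Fin r → A, (∀ i, x i ∈ b) ∧ b ≤ (Ideal.span (Set.range x)).radical := by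
  obtain ⟨s, rfl⟩ := hb
  classical
  induction s using Finset.induction_on with
  | empty => exact ⟨fun _ => 0, fun i => zero_mem _, by simp⟩
  | insert a s _ ih =>
    have hle : Ideal.span (s : Set A) ≤ Ideal.span (insert a s : Finset A) :=
      Ideal.span_mono (by simp)
    obtain ⟨x, hx, hxr⟩ := ih (hle.trans hbm)
    have ha : a ∈ Ideal.span ((insert a s : Finset A) : Set A) := Ideal.subset_span (by simp)
    -- A prime omitting `a` is not the closed point, so its height is less than `r`. The new
    -- generator is thus absorbed without increasing the number of elements.
    obtain ⟨y, hy⟩ := exists_mem_radical_of_height_lt r a x fun p hp => by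
      have hlt : p < IsLocalRing.closedPoint A :=
        lt_of_le_of_ne (IsLocalRing.le_maximalIdeal p.2.ne_top) fun h => hp (h ▸ hbm ha)
      have h1 : ((Order.height p + 1 : ℕ∞) : WithBot ℕ∞) ≤ r :=
        (WithBot.coe_le_coe.2 (Order.height_add_one_le hlt)).trans
          ((Order.height_le_krullDim _).trans hr)
      have h2 : Order.height p + 1 ≤ (r : ℕ∞) := by exact_mod_cast h1
      exact (ENat.add_one_le_iff (ne_top_of_le_ne_top (ENat.natCast_ne_top r)
        (le_self_add.trans h2))).1 h2
    refine ⟨fun i => x i + a * y i, fun i =>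
      add_mem (hle (hx i)) (Ideal.mul_mem_right _ _ ha), ?_⟩
    set J := Ideal.span (Set.range fun i => x i + a * y i)
    have hxJ : (Ideal.span (Set.range x)).radical ≤ J.radical := by
      rw [Ideal.radical_le_radical_iff, Ideal.span_le]
      rintro _ ⟨i, rfl⟩
      have : x i + a * y i ∈ J.radical := Ideal.le_radical (Ideal.subset_span ⟨i, rfl⟩)
      have := sub_mem this (Ideal.mul_mem_right (y i) _ hy)
      rwa [add_sub_cancel_right] at this
    rw [Finset.coe_insert, Ideal.span_insert]
    exact sup_le ((Ideal.span_singleton_le_iff_mem _).2 hy) (hxr.trans hxJ)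

/-! ### Depth, height and dimension of the quotient. -/

theorem mem_span_of_isWeaklyRegular_ofFn {R : Type*} [CommRing R] {k : ℕ} {f : Fin k → R}
    (h : RingTheory.Sequence.IsWeaklyRegular R (List.ofFn f)) (F : ℕ → R)
    (hF : ∀ i : Fin k, F i = f i) (i : ℕ) (hi : i < k) (c : R)
    (hc : F i * c ∈ Ideal.span (F '' Set.Iio i)) : c ∈ Ideal.span (F '' Set.Iio i) := by
  have hspan : (Ideal.ofList ((List.ofFn f).take i) • ⊤ : Submodule R R) =
      Ideal.span (F '' Set.Iio i) := by
    rw [smul_eq_mul, Ideal.mul_top, Ideal.ofList]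
    congr 1
    ext a
    simp only [Set.mem_ofPred_eq, List.mem_take_iff_getElem, List.getElem_ofFn, List.length_ofFn,
      Set.mem_image, Set.mem_Iio]
    constructor
    · rintro ⟨j, hj, rfl⟩
      exact ⟨j, (lt_min_iff.1 hj).1, hF ⟨j, (lt_min_iff.1 hj).2⟩⟩
    · rintro ⟨j, hj, rfl⟩
      exact ⟨j, lt_min hj (hj.trans hi), (hF ⟨j, hj.trans hi⟩).symm⟩
  have hreg := h.regular_mod_prev i (by simpa using hi)
  rw [hspan] at hreg
  rw [List.getElem_ofFn, ← hF ⟨i, hi⟩] at hreg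
  rw [← Submodule.Quotient.mk_eq_zero] at hc ⊢
  refine hreg.right_eq_zero_of_smul ?_
  rw [← Submodule.Quotient.mk_smul]
  exact hc

/-- Every prime containing a finitely generated ideal of depth at least `k` has height at least
`k`. -/
theorem le_height_of_gradeGE {A : Type u} [CommRing A] {b : Ideal A} (hb : b.FG) {k : ℕ}
    (hk : GradeGE b k) (p : PrimeSpectrum A) (hbp : b ≤ p.asIdeal) : (k : ℕ∞) ≤ Order.height p := by
  by_contra hlt
  rw [not_le] at hlt
  obtain ⟨r, rfl⟩ := Nat.exists_eq_succ_of_ne_zero (show k ≠ 0 by rintro rfl; simp at hlt)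
  obtain ⟨N, f, hf, hreg⟩ := hk
  let B := Localization.AtPrime p.asIdeal
  have hdim : ringKrullDim B ≤ r := by
    rw [IsLocalization.AtPrime.ringKrullDim_eq_height p.asIdeal B,
      PrimeSpectrum.height_eq_orderHeight]
    have : Order.height p ≤ (r : ℕ∞) := ENat.lt_natCast_add_one_iff.1 (by exact_mod_cast hlt)
    exact_mod_cast this
  have hbm : b.map (algebraMap A B) ≤ IsLocalRing.maximalIdeal B := by
    rw [← Localization.AtPrime.map_eq_maximalIdeal]
    exact Ideal.map_mono hbp
  obtain ⟨x, hxb, hbx⟩ := exists_le_radical_span hdim (hb.map _) hbm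
  let S := MvPolynomial (Fin N) B
  let _ : Algebra (MvPolynomial (Fin N) A) S := MvPolynomial.algebraMvPolynomial
  let F : ℕ → S := fun i => if h : i < r + 1 then algebraMap (MvPolynomial (Fin N) A) S (f ⟨i, h⟩)
    else 0
  have hF : ∀ i : Fin (r + 1), F i = algebraMap (MvPolynomial (Fin N) A) S (f i) := fun i =>
    dif_pos i.2
  -- Polynomials over `B` are a localization of polynomials over `A` at constants, and weak
  -- regularity survives localization.
  have hregS := hreg.of_isLocalization S
    (p.asIdeal.primeCompl.map (MvPolynomial.C : A →+* MvPolynomial (Fin N) A))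
  rw [List.map_ofFn] at hregS
  have hmap : Ideal.span (Set.range fun i => (MvPolynomial.C (x i) : S)) =
      (Ideal.span (Set.range x)).map MvPolynomial.C := by
    rw [Ideal.map_span, ← Set.range_comp]
    rfl
  have htop := span_eq_top_of_regular r (fun i => (MvPolynomial.C (x i) : S)) F
    (fun i hi => mem_span_of_isWeaklyRegular_ofFn hregS F hF i (Nat.lt_succ_of_le hi))
    (fun i hi => by
      rw [hmap]
      refine Ideal.map_radical_le _ (MvPolynomial.mem_map_C_iff.2 fun m => hbx ?_)
      rw [hF ⟨i, Nat.lt_succ_of_le hi⟩, MvPolynomial.algebraMap_def, MvPolynomial.coeff_map]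
      refine Ideal.mem_map_of_mem _ ?_
      rw [← hf.content_eq ⟨i, Nat.lt_succ_of_le hi⟩]
      exact Ideal.subset_span ⟨m, rfl⟩)
  have h1 : (1 : S) ∈ (IsLocalRing.maximalIdeal B).map MvPolynomial.C := by
    refine Ideal.map_mono (Ideal.span_le.2 ?_) (hmap ▸ htop ▸ Submodule.mem_top)
    rintro _ ⟨i, rfl⟩
    exact hbm (hxb i)
  have := MvPolynomial.mem_map_C_iff.1 h1 0
  rw [MvPolynomial.coeff_zero_one] at this
  exact (Ideal.ne_top_iff_one _).1 (IsLocalRing.maximalIdeal.isMaximal B).ne_top this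

/-- A chain of primes containing `a` begins at a prime of height at least `k`, so a chain of length
`k` can be joined below it. -/
theorem ringKrullDim_quotient_add_le {A : Type u} [CommRing A] (a : Ideal A) (k : ℕ)
    (h : RadGradeGE a k) : ringKrullDim (A ⧸ a) + k ≤ ringKrullDim A := by
  obtain ⟨b, hb, hrad, hk⟩ := h
  have key : ∀ l : LTSeries (PrimeSpectrum (A ⧸ a)),
      ((l.length + k : ℕ) : WithBot ℕ∞) ≤ ringKrullDim A := by
    intro l
    let l' := l.map _ (comap_quotient_mk_strictMono a)
    have ha : a ≤ l'.head.asIdeal := fun z hz => by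
      change Ideal.Quotient.mk a z ∈ l.head.asIdeal
      rw [Ideal.Quotient.eq_zero_iff_mem.2 hz]
      exact zero_mem _
    have hbp : b ≤ l'.head.asIdeal := by
      rw [← l'.head.2.radical_le_iff, hrad, l'.head.2.radical_le_iff]
      exact ha
    obtain ⟨s, hs, hlen⟩ := Order.exists_series_of_le_height _ (le_height_of_gradeGE hb hk _ hbp)
    have := Order.LTSeries.length_le_krullDim (s.smash l' hs)
    rw [RelSeries.smash_length, hlen, add_comm] at this
    exact this
  rcases isEmpty_or_nonempty (PrimeSpectrum (A ⧸ a)) with he | hne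
  · rw [ringKrullDim, Order.krullDim_eq_bot, WithBot.bot_add]
    exact bot_le
  · rcases finiteDimensionalOrder_or_infiniteDimensionalOrder (PrimeSpectrum (A ⧸ a)) with hfin | hinf
    · rw [ringKrullDim, Order.krullDim_eq_length_of_finiteDimensionalOrder]
      exact_mod_cast key _
    · have : ringKrullDim A = ⊤ := by
        refine top_le_iff.1 ?_
        rw [← Order.krullDim_eq_top (α := PrimeSpectrum (A ⧸ a))]
        exact ringKrullDim_quotient_le a
      rw [this]
      exact le_top

/-! ### Cokernels of finite free resolutions. -/

open IsLocalRing in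
/-- Over a local ring, a linear map from a finite free module to `Bⁿ` is injective modulo the
maximal ideal if it sends no vector with a unit coordinate into `𝔪ⁿ`. -/
theorem lTensor_residueField_injective {B : Type*} [CommRing B] [IsLocalRing B] {M : Type*}
    [AddCommGroup M] [Module B M] [Module.Free B M] [Module.Finite B M] {κ : Type*}
    (f : M →ₗ[B] κ → B)
    (hf : ∀ (e : M) (φ : M →ₗ[B] B), φ e = 1 → ∃ i, f e i ∉ maximalIdeal B) :
    Function.Injective (f.lTensor (ResidueField B)) := by
  rw [injective_iff_map_eq_zero]
  intro t ht
  obtain ⟨e, rfl⟩ := TensorProduct.mk_surjective B M (ResidueField B) residue_surjective t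
  have hfe : ∀ i, f e i ∈ maximalIdeal B := by
    intro i
    have := congrArg (fun z => TensorProduct.rid B (ResidueField B)
      (LinearMap.lTensor (ResidueField B) (LinearMap.proj (φ := fun _ : κ => B) i) z)) ht
    simp only [TensorProduct.mk_apply, LinearMap.lTensor_tmul, LinearMap.proj_apply,
      TensorProduct.rid_tmul, map_zero] at this
    rw [← residue_eq_zero_iff]
    rwa [Algebra.smul_def, mul_one] at this
  let b := Module.Free.chooseBasis B M
  have hcoord : ∀ j, b.repr e j ∈ maximalIdeal B := by
    intro j
    by_contra hj
    obtain ⟨v, hv⟩ := notMem_maximalIdeal.1 hj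
    -- The coordinate form divided by its unit value takes the value `1` on `e`.
    obtain ⟨i, hi⟩ := hf e ((↑v⁻¹ : B) • b.coord j) (by simp [← hv])
    exact hi (hfe i)
  rw [← b.sum_repr e, map_sum]
  refine Finset.sum_eq_zero fun j _ => ?_
  have hres : (b.repr e j) • (1 : ResidueField B) = 0 := by
    rw [Algebra.smul_def, mul_one]
    exact (residue_eq_zero_iff _).2 (hcoord j)
  rw [map_smul, TensorProduct.mk_apply, TensorProduct.smul_tmul', hres, TensorProduct.zero_tmul]

/-- Over a local ring of dimension at most `r`, the cokernels in degrees at least `r` of a bounded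
exact complex of finite free modules are free. -/
theorem free_cokernel_of_isLocalRing {B : Type u} [CommRing B] [IsLocalRing B] {r : ℕ}
    (hr : ringKrullDim B ≤ r) {ι : ℕ → Type v} [∀ i, Fintype (ι i)]
    {D : ∀ i, Matrix (ι i) (ι (i + 1)) B} (hD : MatrixExact D) {n : ℕ}
    (hn : ∀ i, n < i → IsEmpty (ι i)) :
    ∀ i, r ≤ i → Module.Free B ((ι i → B) ⧸ LinearMap.range (D i).mulVecLin) := by
  suffices h : ∀ k i, r ≤ i → n < i + k →
      Module.Free B ((ι i → B) ⧸ LinearMap.range (D i).mulVecLin) from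
    fun i hi => h (n + 1) i hi (by omega)
  intro k
  induction k with
  | zero =>
    intro i _ hi
    have := hn i hi
    have : Subsingleton ((ι i → B) ⧸ LinearMap.range (D i).mulVecLin) :=
      (Submodule.mkQ_surjective _).subsingleton
    infer_instance
  | succ k ih =>
    intro i hi hk
    classical
    -- Descending induction: the cokernel in degree `i + 1` is free and maps onto the image of `D
    -- i`. The cokernel in degree `i` is free once this map is injective modulo the maximal ideal.
    have := ih (i + 1) (by omega) (by omega)
    have hle : LinearMap.range (D (i + 1)).mulVecLin ≤ LinearMap.ker (D i).mulVecLin := by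
      rintro _ ⟨u, rfl⟩
      exact hD.mulVec_mulVec i u
    let f := Submodule.liftQ _ (D i).mulVecLin hle
    have hex : Function.Exact f (LinearMap.range (D i).mulVecLin).mkQ := by
      rw [LinearMap.exact_iff, Submodule.ker_mkQ, Submodule.range_liftQ]
    refine Module.free_of_lTensor_residueField_injective f _ (Submodule.mkQ_surjective _) hex
      (lTensor_residueField_injective f fun e φ he => ?_)
    by_contra! hmem
    obtain ⟨e, rfl⟩ := Submodule.mkQ_surjective _ e
    have hfe : f (Submodule.mkQ _ e) = D i *ᵥ e := rfl
    rw [hfe] at hmem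
    have hbm : Ideal.span (Set.range (D i *ᵥ e)) ≤ IsLocalRing.maximalIdeal B := by
      rw [Ideal.span_le]
      rintro _ ⟨a, rfl⟩
      exact hmem a
    -- Otherwise the coordinates of `D i *ᵥ e` lie in the radical of an ideal generated by `r ≤ i`
    -- non-units, while the pullback of `φ` kills boundaries and is `1` at `e`.
    obtain ⟨x, hx, hxr⟩ := exists_le_radical_span hr
      ⟨(Set.finite_range (D i *ᵥ e)).toFinset, by simp⟩ hbm
    let ψ := φ ∘ₗ Submodule.mkQ (LinearMap.range (D (i + 1)).mulVecLin)
    let l : ι (i + 1) → B := fun a => ψ (Pi.single a 1)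
    have hl : ∀ w, l ⬝ᵥ w = ψ w := fun w => by
      rw [LinearMap.pi_apply_eq_sum_univ ψ w]
      refine Finset.sum_congr rfl fun a _ => ?_
      rw [smul_eq_mul, mul_comm]
      congr 1
      refine congrArg ψ (funext fun b => ?_)
      simp [Pi.single_apply, eq_comm]
    have htop := span_eq_top_of_matrixExact r x D i e l hD hi
      (funext fun a => by
        rw [← dotProduct_single_one (l ᵥ* D (i + 1)) a, ← Matrix.dotProduct_mulVec, hl]
        have : Submodule.mkQ (LinearMap.range (D (i + 1)).mulVecLin)
            (D (i + 1) *ᵥ Pi.single a 1) = 0 :=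
          (Submodule.Quotient.mk_eq_zero _).2 ⟨Pi.single a 1, rfl⟩
        simp only [ψ, LinearMap.comp_apply, this, map_zero, Pi.zero_apply])
      ((hl e).trans he) (fun a => hxr (Ideal.subset_span ⟨a, rfl⟩))
    refine (IsLocalRing.maximalIdeal.isMaximal B).ne_top (top_le_iff.1 ?_)
    rw [← htop, Ideal.span_le]
    rintro _ ⟨a, rfl⟩
    exact hbm (hx a)

theorem map_algebraMap_mulVec {A B : Type*} [CommRing A] [CommRing B] [Algebra A B]
    {m n : Type*} [Fintype n] (M : Matrix m n A) (w : n → A) :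
    (M.map (algebraMap A B) *ᵥ fun a => algebraMap A B (w a)) =
      fun a => algebraMap A B ((M *ᵥ w) a) := by
  funext a
  simp [Matrix.mulVec, dotProduct]

theorem MatrixExact.localization {A B : Type*} [CommRing A] [CommRing B] [Algebra A B]
    (S : Submonoid A) [IsLocalization S B] {ι : ℕ → Type*} [∀ i, Fintype (ι i)]
    {D : ∀ i, Matrix (ι i) (ι (i + 1)) A} (hD : MatrixExact D) :
    MatrixExact fun i => (D i).map (algebraMap A B) where
  mul_eq_zero i := by
    rw [← Matrix.map_mul, hD.mul_eq_zero, Matrix.map_zero _ (map_zero _)]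
  exact i w hw := by
    let F := fun κ : Type _ => LinearMap.pi fun a : κ =>
      Algebra.linearMap A B ∘ₗ LinearMap.proj (φ := fun _ : κ => A) a
    obtain ⟨⟨y, s⟩, hy⟩ := IsLocalizedModule.surj S (F (ι (i + 1))) w
    have hy' : algebraMap A B s • w = fun a => algebraMap A B (y a) := by
      rw [algebraMap_smul]
      exact hy
    have h1 : F (ι i) (D i *ᵥ y) = F (ι i) 0 := by
      rw [map_zero]
      change (fun a => algebraMap A B ((D i *ᵥ y) a)) = 0
      rw [← map_algebraMap_mulVec, ← hy', Matrix.mulVec_smul, hw, smul_zero]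
    obtain ⟨t, ht⟩ := IsLocalizedModule.exists_of_eq (S := S) h1
    obtain ⟨u, hu⟩ := hD.exact i ((t : A) • y) (by
      rw [Matrix.mulVec_smul]
      rw [smul_zero] at ht
      exact ht)
    obtain ⟨c, hc⟩ := (IsLocalization.map_units B (t * s)).exists_left_inv
    refine ⟨c • fun a => algebraMap A B (u a), ?_⟩
    rw [Matrix.mulVec_smul, map_algebraMap_mulVec, ← hu]
    have : (fun a => algebraMap A B (((t : A) • y) a)) =
        algebraMap A B t • algebraMap A B s • w := by
      rw [hy']
      funext a
      simp
    rw [Submonoid.coe_mul, map_mul, ← mul_assoc] at hc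
    rw [this, smul_smul, smul_smul, hc, one_smul]

/-- The cokernels in degrees at least `r` of a bounded exact complex of finite free modules over a
ring of dimension at most `r` are projective. -/
theorem projective_cokernel {A : Type u} [CommRing A] {r : ℕ}
    (hr : ringKrullDim A ≤ r) {ι : ℕ → Type v} [∀ i, Fintype (ι i)]
    {D : ∀ i, Matrix (ι i) (ι (i + 1)) A} (hD : MatrixExact D) {n : ℕ}
    (hn : ∀ i, n < i → IsEmpty (ι i)) (i : ℕ) (hi : r ≤ i) :
    Module.Projective A ((ι i → A) ⧸ LinearMap.range (D i).mulVecLin) := by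
  -- Finite presentation lets projectivity be checked at maximal ideals.
  have : Module.FinitePresentation A ((ι i → A) ⧸ LinearMap.range (D i).mulVecLin) :=
    Module.finitePresentation_of_free_of_surjective (Submodule.mkQ _)
      (Submodule.mkQ_surjective _) (by
        rw [Submodule.ker_mkQ, LinearMap.range_eq_map]
        exact Module.Finite.fg_top.map _)
  let F (P : Ideal A) [P.IsMaximal] := LinearMap.pi fun a : ι i =>
    Algebra.linearMap A (Localization.AtPrime P) ∘ₗ LinearMap.proj (φ := fun _ : ι i => A) a
  refine Module.projective_of_localization_maximal' (fun P _ => Localization.AtPrime P)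
    (fun P _ => (ι i → Localization.AtPrime P) ⧸ (LinearMap.range (D i).mulVecLin).localized'
      (Localization.AtPrime P) P.primeCompl (F P))
    (fun P _ => (LinearMap.range (D i).mulVecLin).toLocalizedQuotient' (Localization.AtPrime P)
      P.primeCompl (F P)) fun P _ => ?_
  have hrange : (LinearMap.range (D i).mulVecLin).localized' (Localization.AtPrime P) P.primeCompl
      (F P) = LinearMap.range ((D i).map (algebraMap A (Localization.AtPrime P))).mulVecLin := by
    rw [Matrix.range_mulVecLin, Matrix.range_mulVecLin, Submodule.localized'_span,
      ← Set.range_comp]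
    rfl
  rw [hrange]
  have hdim : ringKrullDim (Localization.AtPrime P) ≤ r := by
    rw [IsLocalization.AtPrime.ringKrullDim_eq_height P]
    exact Ideal.height_le_ringKrullDim_of_isPrime.trans hr
  have := free_cokernel_of_isLocalRing hdim
    (hD.localization (B := Localization.AtPrime P) P.primeCompl) hn i hi
  infer_instance

/-! ### Truncating a resolution. -/

namespace Resolution

variable {A : Type u} [CommRing A] {M : Type v} [AddCommGroup M] [Module A M] {n : ℕ}

/-- In a free resolution of length `n` over a ring of dimension at most `r`, the cokernels of the
differentials in degrees at least `r` are projective. -/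
theorem projective_coker (R : Resolution A M n)
    (hfree : ∀ i, Module.Free A (R.L i) ∧ Module.Finite A (R.L i)) {r : ℕ}
    (hr : ringKrullDim A ≤ r) (i : ℕ) (hi : r ≤ i) :
    Module.Projective A (R.L i ⧸ LinearMap.range (R.d i)) := by
  classical
  -- Over the zero ring a basis of a zero module may have a nonempty index set, so the vanishing of
  -- the matrices in high degrees needs `A` nontrivial.
  rcases subsingleton_or_nontrivial A with hA | hA
  · have := Module.subsingleton A (R.L i ⧸ LinearMap.range (R.d i))
    infer_instance
  have h1 := fun i => (hfree i).1
  have h2 := fun i => (hfree i).2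
  let b := fun i => Module.Free.chooseBasis A (R.L i)
  let D := fun i => LinearMap.toMatrix (b (i + 1)) (b i) (R.d i)
  have hmul : ∀ i w, D i *ᵥ w = (b i).equivFun (R.d i ((b (i + 1)).equivFun.symm w)) := by
    intro i w
    have := LinearMap.toMatrix_mulVec_repr (b (i + 1)) (b i) (R.d i)
      ((b (i + 1)).equivFun.symm w)
    rw [← Module.Basis.equivFun_apply, LinearEquiv.apply_symm_apply] at this
    exact this
  have hD : MatrixExact D := by
    refine ⟨fun i => ?_, fun i w hw => ?_⟩
    · rw [← LinearMap.toMatrix_comp, (R.exact_succ i).linearMap_comp_eq_zero, map_zero]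
    · rw [hmul, LinearEquiv.map_eq_zero_iff] at hw
      obtain ⟨u, hu⟩ := (R.exact_succ i _).1 hw
      refine ⟨(b (i + 2)).equivFun u, ?_⟩
      rw [hmul, LinearEquiv.symm_apply_apply, hu, LinearEquiv.apply_symm_apply]
  have hn : ∀ i, n < i → IsEmpty (Module.Free.ChooseBasisIndex A (R.L i)) := fun i hi => by
    have := R.subsingleton i hi
    exact ⟨fun a => (b i).ne_zero a (Subsingleton.elim _ _)⟩
  have := projective_cokernel hr hD hn i hi
  refine Module.Projective.of_equiv (Submodule.Quotient.equiv
    (LinearMap.range (D i).mulVecLin) (LinearMap.range (R.d i)) (b i).equivFun.symm ?_)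
  rw [← LinearMap.range_comp]
  apply le_antisymm
  · rintro _ ⟨w, rfl⟩
    refine ⟨(b (i + 1)).equivFun.symm w, ?_⟩
    change _ = (b i).equivFun.symm (D i *ᵥ w)
    rw [hmul, LinearEquiv.symm_apply_apply]
  · rintro _ ⟨u, rfl⟩
    refine ⟨(b (i + 1)).equivFun u, ?_⟩
    change (b i).equivFun.symm (D i *ᵥ _) = _
    rw [hmul, LinearEquiv.symm_apply_apply, LinearEquiv.symm_apply_apply]

/-- The subcomplex of a resolution by which one divides in order to truncate it in degree `r`. -/
def truncSubmodule (R : Resolution A M n) (r i : ℕ) : Submodule A (R.L i) :=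
  if i < r then ⊥ else if i = r then LinearMap.range (R.d i) else ⊤

variable (R : Resolution A M n)

theorem truncSubmodule_of_lt {r i : ℕ} (h : i < r) : R.truncSubmodule r i = ⊥ := by
  simp [truncSubmodule, h]

theorem truncSubmodule_self (r : ℕ) : R.truncSubmodule r r = LinearMap.range (R.d r) := by
  simp [truncSubmodule]

theorem truncSubmodule_of_gt {r i : ℕ} (h : r < i) : R.truncSubmodule r i = ⊤ := by
  simp [truncSubmodule, h.not_gt, h.ne']

theorem range_le_truncSubmodule {r i : ℕ} (h : r ≤ i) :
    LinearMap.range (R.d i) ≤ R.truncSubmodule r i := by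
  rcases h.eq_or_lt with rfl | h
  · rw [truncSubmodule_self]
  · rw [truncSubmodule_of_gt _ h]
    exact le_top

theorem truncSubmodule_le_range {r i : ℕ} (h : i ≤ r) :
    R.truncSubmodule r i ≤ LinearMap.range (R.d i) := by
  rcases h.eq_or_lt with rfl | h
  · rw [truncSubmodule_self]
  · rw [truncSubmodule_of_lt _ h]
    exact bot_le

theorem truncSubmodule_le_comap (r i : ℕ) :
    R.truncSubmodule r (i + 1) ≤ (R.truncSubmodule r i).comap (R.d i) := by
  rcases Nat.lt_or_ge i r with h | h
  · intro y hy
    obtain ⟨u, rfl⟩ := R.truncSubmodule_le_range h hy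
    rw [Submodule.mem_comap, (R.exact_succ i).apply_apply_eq_zero]
    exact zero_mem _
  · exact fun y _ => R.range_le_truncSubmodule h ⟨y, rfl⟩

theorem truncSubmodule_zero_le_ker (r : ℕ) :
    R.truncSubmodule r 0 ≤ LinearMap.ker R.augmentation := by
  intro y hy
  obtain ⟨u, rfl⟩ := R.truncSubmodule_le_range (Nat.zero_le r) hy
  exact R.exact_zero.apply_apply_eq_zero u

/-- The truncation of a resolution in degree `r`, with the cokernel of the differential in
degree `r`. -/
noncomputable def trunc (r : ℕ) : Resolution A M r where
  L i := R.L i ⧸ R.truncSubmodule r i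
  addCommGroup i := inferInstance
  module i := inferInstance
  d i := Submodule.mapQ _ _ (R.d i) (R.truncSubmodule_le_comap r i)
  augmentation := Submodule.liftQ _ R.augmentation (R.truncSubmodule_zero_le_ker r)
  augmentation_surjective m := by
    obtain ⟨y, rfl⟩ := R.augmentation_surjective m
    exact ⟨Submodule.Quotient.mk y, rfl⟩
  exact_zero := by
    intro y
    obtain ⟨y, rfl⟩ := Submodule.Quotient.mk_surjective _ y
    constructor
    · intro hy
      obtain ⟨z, rfl⟩ := (R.exact_zero y).1 hy
      exact ⟨Submodule.Quotient.mk z, rfl⟩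
    · rintro ⟨z, hz⟩
      obtain ⟨z, rfl⟩ := Submodule.Quotient.mk_surjective _ z
      rw [← hz]
      exact R.exact_zero.apply_apply_eq_zero z
  exact_succ i := by
    intro y
    obtain ⟨y, rfl⟩ := Submodule.Quotient.mk_surjective _ y
    constructor
    · intro hy
      rcases Nat.lt_or_ge i r with h | h
      · have hy' : R.d i y ∈ R.truncSubmodule r i := (Submodule.Quotient.mk_eq_zero _).1 hy
        rw [R.truncSubmodule_of_lt h, Submodule.mem_bot] at hy'
        obtain ⟨z, rfl⟩ := (R.exact_succ i y).1 hy'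
        exact ⟨Submodule.Quotient.mk z, rfl⟩
      · refine ⟨0, ?_⟩
        rw [map_zero, eq_comm, Submodule.Quotient.mk_eq_zero,
          R.truncSubmodule_of_gt (Nat.lt_succ_of_le h)]
        exact Submodule.mem_top
    · rintro ⟨z, hz⟩
      obtain ⟨z, rfl⟩ := Submodule.Quotient.mk_surjective _ z
      rw [← hz]
      change Submodule.Quotient.mk (R.d i (R.d (i + 1) z)) = 0
      rw [(R.exact_succ i).apply_apply_eq_zero, Submodule.Quotient.mk_zero]
  subsingleton i hi := by
    rw [R.truncSubmodule_of_gt hi]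
    infer_instance

end Resolution

theorem hasFiniteProjectiveResolution {A : Type u} [CommRing A] {r : ℕ}
    (hr : ringKrullDim A ≤ r) (M : Type v) [AddCommGroup M] [Module A M]
    (h : FreelyResolvable A M) : HasFiniteProjectiveResolution A M r := by
  obtain ⟨n, R, hR⟩ := h
  refine ⟨R.trunc r, fun i => ?_⟩
  have h1 := (hR i).1
  have h2 := (hR i).2
  change Module.Projective A (R.L i ⧸ R.truncSubmodule r i) ∧
    Module.Finite A (R.L i ⧸ R.truncSubmodule r i)
  refine ⟨?_, inferInstance⟩
  rcases lt_trichotomy i r with h | rfl | h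
  · exact Module.Projective.of_equiv (Submodule.quotEquivOfEqBot _ (R.truncSubmodule_of_lt h)).symm
  · rw [R.truncSubmodule_self]
    exact R.projective_coker hR hr i le_rfl
  · rw [R.truncSubmodule_of_gt h]
    infer_instance

end KrullGrade

theorem mainTheorem10 (A : Type u) [CommRing A] :
    (∀ r : ℕ, ringKrullDim A ≤ r →
      ∀ a : Ideal A, a.FG → KrullGrade.GradeGE a (r + 1) → (1 : A) ∈ a) ∧
    (∀ (a : Ideal A) (k : ℕ), KrullGrade.RadGradeGE a k →
      ringKrullDim (A ⧸ a) + k ≤ ringKrullDim A) ∧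
    (∀ r : ℕ, ringKrullDim A ≤ r →
      ∀ (M : Type v) [AddCommGroup M] [Module A M],
        KrullGrade.FreelyResolvable A M → KrullGrade.HasFiniteProjectiveResolution A M r) := by
  refine ⟨fun r hr a ha hk => ?_, KrullGrade.ringKrullDim_quotient_add_le,
    fun r hr M _ _ h => KrullGrade.hasFiniteProjectiveResolution hr M h⟩
  by_contra h1
  -- A maximal ideal containing `a` would have height at least `r + 1`.
  obtain ⟨m, hm, ham⟩ := Ideal.exists_le_maximal a ((Ideal.ne_top_iff_one a).2 h1)
  have h2 := KrullGrade.le_height_of_gradeGE ha hk ⟨m, hm.isPrime⟩ ham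
  have h3 : (((r + 1 : ℕ) : ℕ∞) : WithBot ℕ∞) ≤ r :=
    (WithBot.coe_le_coe.2 h2).trans ((Order.height_le_krullDim _).trans hr)
  have h4 : r + 1 ≤ r := by exact_mod_cast h3
  omega
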